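/- **Setting.** Fix a domain $\mathcal E$, a set of program locations and a set $v_r$ of program variables; put $v=\{pc\}\cup v_r$. Assertions are formulas of a background theory with a fixed model over $\mathcal E$. A *program* $D=\langle v,init(v),next(v,v'),J\rangle$ consists of an initial condition, a transition relation and a finite list $J=\{J_1,\dots,J_{|J|}\}$ of fairness conditions. A *path* is an infinite sequence of states related by $next$; it is *fair* if every $J_i$ holds infinitely often on it. $CTL^*$ formulas are in negation normal form, built from assertions and negated assertions with $\wedge,\vee,X,G,U$ and the path quantifiers $E,A$ (over all paths from the current state) and $E_f,A_f$ (over the fair ones). $D\models\phi$, for a state formula $\phi$, means that $\phi$ holds in every initial state. A *basic* state formula is a formula $Q\psi$ whose only path quantifier is $Q$. **Clauses.** Existential Horn clauses are implications, implications with an existentially quantified head, and conditions $dwf(r)$ saying that the interpretation of the uninterpreted predicate $r$ is contained in a finite union of relations without infinite chains. An interpretation $\mathcal I$ of the uninterpreted predicates by arbitrary relations satisfies a clause if the universal closure of the clause is true under $\mathcal I$. $Clauses(D,\phi)$ denotes any set obtained by the following rules, where $D=(v,init,next,J)$, all new predicates $aux,p,q,q_i,r,r_i,t$ and Boolean variables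 $x$ are fresh, and $c,c_1,c_2$ are assertions (possibly mentioning uninterpreted predicates). $\phi_2(\chi)$ denotes a formula with at least one occurrence of $\chi$, and $\phi_2(\gamma)$ the result of replacing all of them by $\gamma$. 1. For a basic state formula $\phi_1$: $Clauses(D,\phi_2(\phi_1))=Clauses((v,aux(v),next,J),\phi_1)\cup Clauses(D,\phi_2(aux(v)))$. 2. For a basic state formula $Q\psi$ with $Q\in\{E,A\}$: $Clauses(D,Q\psi)=Clauses((v,init,next,\emptyset),Q_f\psi)$. 3. – 5. Let $Q_f\psi(\chi)$ be basic with $\chi$ one of $Xc$, $Gc$, $c_1Uc_2$. Let $\tau$ be, respectively, $x=c(v')$; $x=(c(v)\wedge x')$; $x=(c_2(v)\vee(c_1(v)\wedge x'))$, and let $J'$ be, respectively, $J$; $J\cup\{x\vee\neg c(v)\}$; $J\cup\{\neg x\vee c_2(v)\}$. Then $Clauses(D,A_f\psi(\chi))=Clauses((v\cup\{x\},init,next\wedge\tau,J'),A_f\psi(x))$ and $Clauses(D,E_f\psi(\chi))=\{init(v)\to\exists x: aux(v,x)\}\cup Clauses((v\cup\{x\},aux(v,x),next\wedge\tau,J'),E_f\psi(x))$.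 6. $Clauses(D,A_fc)=\{init(v)\wedge\neg c(v)\to p(v),\ next(v,v')\wedge p(v)\to p(v'),\ dwf(r),\ next(v,v')\to t(v,v'),\ t(v,v')\wedge next(v',v'')\to t(v,v'')\}$ together with $p(v_0)\wedge\bigwedge_{i=1}^{|J|}(t(v_{i-1},v_i)\wedge J_i(v_i))\to r(v_0,v_{|J|})$ if $J\ne\emptyset$, and with $p(v)\wedge t(v,v')\to r(v,v')$ if $J=\emptyset$. 7. If $J\neq\emptyset$: $Clauses(D,E_fc)=\{init(v)\to c(v)\wedge q_1(v)\}\cup\{q_i(v)\to\exists v': next(v,v')\wedge((J_i(v)\wedge q_{(i\bmod|J|)+1}(v'))\vee(r_i(v,v')\wedge q_i(v'))),\ dwf(r_i),\ r_i(v,v')\wedge r_i(v',v'')\to r_i(v,v'')\mid 1\le i\le|J|\}$. If $J=\emptyset$: $Clauses(D,E_fc)=\{init(v)\to c(v)\wedge q(v),\ q(v)\to\exists v': next(v,v')\wedge q(v')\}$. 8. $Clauses(D,c)=\{init(v)\to c(v)\}$. **Partial programs.** A *partial program* $\langle P,H\rangle$ is a program $P=\langle v,init,next,J\rangle$ with a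 finite set $H$ of condition holes $\langle l,l_t,l_f\rangle$ and assignment holes $\langle l,l'\rangle$ (tuples of locations). A *resolving function* $\Psi$ maps every condition hole to a subset of $\mathcal E^{|v_r|}$ and every assignment hole to a relation $\Psi(\langle l,l'\rangle)\subseteq\mathcal E^{|v_r|}\times\mathcal E^{|v_r|}$ with $\forall v_r\,\exists v_r':\Psi(\langle l,l'\rangle)(v_r,v_r')$. The program $P_\Psi$ is $P$ with the transition relation $$next_\Psi=next\vee\bigvee_{\langle l,l_t,l_f\rangle\in H}\big(pc=l\wedge v_r'=v_r\wedge((pc'=l_t\wedge\Psi(\langle l,l_t,l_f\rangle)(v_r))\vee(pc'=l_f\wedge\neg\Psi(\langle l,l_t,l_f\rangle)(v_r)))\big)\vee\bigvee_{\langle l,l'\rangle\in H}\big(pc=l\wedge pc'=l'\wedge\Psi(\langle l,l'\rangle)(v_r,v_r')\big).$$ $P_U$ is obtained in the same way with the uninterpreted predicates $u^c_l(v_r)$ and $u^a_l(v_r,v_r')$ in place of $\Psi(\langle l,l_t,l_f\rangle)$ and $\Psi(\langle l,l'\rangle)$. Let $\Delta_a(P,H)=\{\top\to\exists v_r':u^a_l(v_r,v_r')\mid\langle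 l,l'\rangle\in H\}$ and $\Delta(P,H,\phi)=\Delta_a(P,H)\cup Clauses(P_U,\phi)$. **Theorem (soundness of synthesis).** Let $\langle P,H\rangle$ be a partial program and $\phi$ a $CTL^*$ state formula over its variables. Suppose that some set $\Delta(P,H,\phi)$ produced by the rules is satisfied by an interpretation $\mathcal I$. Define $\Psi(\langle l,l_t,l_f\rangle)(v_r)=\mathcal I(u^c_l)(v_r)$ for every condition hole and $\Psi(\langle l,l'\rangle)(v_r,v_r')=\mathcal I(u^a_l)(v_r,v_r')$ for every assignment hole of $H$. Then $\Psi$ is a resolving function for $\langle P,H\rangle$, and $P_\Psi$ satisfies $\phi$. -/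

import Mathlib

universe u

namespace EHC

/-! ### CTL* over infinite paths of a transition system with fairness conditions -/

/-- A program whose states are the elements of `σ`: an initial condition, a transition relation and
a finite (enumerated) collection of fairness conditions. -/
structure Program (σ : Type u) where
  init : σ → Prop
  next : σ → σ → Prop
  fair : List (σ → Prop)

/-- An infinite sequence of states that follows the transition relation. -/
def Program.IsPath {σ : Type u} (D : Program σ) (π : ℕ → σ) : Prop :=
  ∀ i, D.next (π i) (π (i + 1))

/-- A path on which every fairness condition holds infinitely often. -/
def Program.IsFairPath {σ : Type u} (D : Program σ) (π : ℕ → σ) : Prop :=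
  D.IsPath π ∧ ∀ j ∈ D.fair, ∀ i, ∃ k, i ≤ k ∧ j (π k)

/-- Path quantifiers: `E`, `A` range over all paths, `Ef`, `Af` over the fair ones. -/
inductive PathQuant
  | E
  | A
  | Ef
  | Af

/-- `Q.Holds D s T`: for some / for every path (resp. fair path) `π` of `D` that starts
in `s`, the property `T` holds of `π`. -/
def PathQuant.Holds {σ : Type u} (D : Program σ) (s : σ) (T : (ℕ → σ) → Prop) : PathQuant → Prop
  | .E => ∃ π, D.IsPath π ∧ π 0 = s ∧ T π
  | .A => ∀ π, D.IsPath π → π 0 = s → T π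
  | .Ef => ∃ π, D.IsFairPath π ∧ π 0 = s ∧ T π
  | .Af => ∀ π, D.IsFairPath π → π 0 = s → T π

/-- CTL* formulas in negation normal form, with atomic assertions from `α`. -/
inductive Formula (α : Type u) : Type u
  | atom (c : α)
  | natom (c : α)
  | and (φ ψ : Formula α)
  | or (φ ψ : Formula α)
  | X (φ : Formula α)
  | G (φ : Formula α)
  | U (φ ψ : Formula α)
  | quant (Q : PathQuant) (φ : Formula α)

namespace Formula

variable {α β : Type u}

/-- State formulas: Boolean combinations of literals and of path-quantified formulas. -/
def IsState : Formula α → Prop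
  | .atom _ => True
  | .natom _ => True
  | .and φ ψ => φ.IsState ∧ ψ.IsState
  | .or φ ψ => φ.IsState ∧ ψ.IsState
  | .quant _ _ => True
  | _ => False

/-- Assertions: no temporal operator and no path quantifier. -/
def IsAssertion : Formula α → Prop
  | .atom _ => True
  | .natom _ => True
  | .and φ ψ => φ.IsAssertion ∧ ψ.IsAssertion
  | .or φ ψ => φ.IsAssertion ∧ ψ.IsAssertion
  | _ => False

/-- No path quantifier occurs in the formula. -/
def QuantFree : Formula α → Prop
  | .atom _ => True
  | .natom _ => True
  | .and φ ψ => φ.QuantFree ∧ ψ.QuantFree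
  | .or φ ψ => φ.QuantFree ∧ ψ.QuantFree
  | .X φ => φ.QuantFree
  | .G φ => φ.QuantFree
  | .U φ ψ => φ.QuantFree ∧ ψ.QuantFree
  | .quant _ _ => False

/-- Basic state formulas `Q ψ`: the leading path quantifier is the only one. -/
def IsBasic : Formula α → Prop
  | .quant _ ψ => ψ.QuantFree
  | _ => False

/-- Rename the atomic assertions. -/
def map (f : α → β) : Formula α → Formula β
  | .atom c => .atom (f c)
  | .natom c => .natom (f c)
  | .and φ ψ => .and (φ.map f) (ψ.map f)
  | .or φ ψ => .or (φ.map f) (ψ.map f)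
  | .X φ => .X (φ.map f)
  | .G φ => .G (φ.map f)
  | .U φ ψ => .U (φ.map f) (ψ.map f)
  | .quant Q φ => .quant Q (φ.map f)

/-- `φ.Contains χ`: the formula `χ` occurs in `φ` as a subformula. -/
def Contains : (φ χ : Formula α) → Prop
  | .atom c, χ => .atom c = χ
  | .natom c, χ => .natom c = χ
  | .and φ ψ, χ => .and φ ψ = χ ∨ φ.Contains χ ∨ ψ.Contains χ
  | .or φ ψ, χ => .or φ ψ = χ ∨ φ.Contains χ ∨ ψ.Contains χ
  | .X φ, χ => .X φ = χ ∨ φ.Contains χ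
  | .G φ, χ => .G φ = χ ∨ φ.Contains χ
  | .U φ ψ, χ => .U φ ψ = χ ∨ φ.Contains χ ∨ ψ.Contains χ
  | .quant Q φ, χ => .quant Q φ = χ ∨ φ.Contains χ

open Classical in
/-- `φ.replace χ γ`: every occurrence of `χ` in `φ` is replaced by `γ`. -/
noncomputable def replace : (φ χ γ : Formula α) → Formula α
  | .atom c, χ, γ => if .atom c = χ then γ else .atom c
  | .natom c, χ, γ => if .natom c = χ then γ else .natom c
  | .and φ ψ, χ, γ => if .and φ ψ = χ then γ else .and (φ.replace χ γ) (ψ.replace χ γ)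
  | .or φ ψ, χ, γ => if .or φ ψ = χ then γ else .or (φ.replace χ γ) (ψ.replace χ γ)
  | .X φ, χ, γ => if .X φ = χ then γ else .X (φ.replace χ γ)
  | .G φ, χ, γ => if .G φ = χ then γ else .G (φ.replace χ γ)
  | .U φ ψ, χ, γ => if .U φ ψ = χ then γ else .U (φ.replace χ γ) (ψ.replace χ γ)
  | .quant Q φ, χ, γ => if .quant Q φ = χ then γ else .quant Q (φ.replace χ γ)

/-- Satisfaction of a formula along a sequence of states. -/
def PathSat {σ : Type u} (D : Program σ) : Formula (σ → Prop) → (ℕ → σ) → Prop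
  | .atom c, π => c (π 0)
  | .natom c, π => ¬ c (π 0)
  | .and φ ψ, π => φ.PathSat D π ∧ ψ.PathSat D π
  | .or φ ψ, π => φ.PathSat D π ∨ ψ.PathSat D π
  | .X φ, π => φ.PathSat D (fun k => π (k + 1))
  | .G φ, π => ∀ i, φ.PathSat D (fun k => π (k + i))
  | .U φ ψ, π => ∃ j, ψ.PathSat D (fun k => π (k + j)) ∧
      ∀ i < j, φ.PathSat D (fun k => π (k + i))
  | .quant Q φ, π => Q.Holds D (π 0) (fun π' => φ.PathSat D π')

/-- Satisfaction of a state formula in a state. It is only used for state formulas, so the value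
at a formula that starts with a temporal operator does not matter. -/
def StateSat {σ : Type u} (D : Program σ) : Formula (σ → Prop) → σ → Prop
  | .atom c, s => c s
  | .natom c, s => ¬ c s
  | .and φ ψ, s => φ.StateSat D s ∧ ψ.StateSat D s
  | .or φ ψ, s => φ.StateSat D s ∨ ψ.StateSat D s
  | .quant Q φ, s => Q.Holds D s (fun π => φ.PathSat D π)
  | _, _ => False

end Formula

/-- A program satisfies a state formula if all of its initial states do. -/
def Program.Satisfies {σ : Type u} (D : Program σ) (φ : Formula (σ → Prop)) : Prop :=
  ∀ s, D.init s → φ.StateSat D s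

/-! ### States, uninterpreted predicates and existential Horn clauses -/

/-- Valuations of the program variables `{pc} ∪ v_r`. -/
structure PState (Loc Var E : Type u) : Type u where
  pc : Loc
  vr : Var → E

/-- Valuations of the program variables together with `n` added Boolean variables. -/
@[reducible] def State (Loc Var E : Type u) : ℕ → Type u
  | 0 => PState Loc Var E
  | n + 1 => State Loc Var E n × Bool

/-- Uninterpreted predicate symbols: the hole predicates `u^c_l` and `u^a_l`, and a supply of names
(the second argument) for predicates over one copy or over two copies of the program variables and
`n` Boolean variables. -/
inductive Sym (Loc : Type u) : Type u
  | cond (l : Loc)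
  | asgn (l : Loc)
  | one (n : ℕ) (name : ℕ)
  | two (n : ℕ) (name : ℕ)

/-- The tuples that an uninterpreted predicate takes as arguments. -/
@[reducible] def Sym.Args {Loc : Type u} (Var E : Type u) : Sym Loc → Type u
  | .cond _ => Var → E
  | .asgn _ => (Var → E) × (Var → E)
  | .one n _ => State Loc Var E n
  | .two n _ => State Loc Var E n × State Loc Var E n

/-- An interpretation of the uninterpreted predicates. -/
def Interp (Loc Var E : Type u) : Type u :=
  (p : Sym Loc) → p.Args Var E → Prop

/-- Formulas over the background theory and the uninterpreted predicates. `Γ` is the type of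
valuations of the free variables; theory constraints and argument tuples are given by their
meaning in the fixed model of the theory. -/
inductive Fm (Loc Var E : Type u) (Γ : Type u) : Type u
  | constr (R : Γ → Prop)
  | pred (p : Sym Loc) (t : Γ → p.Args Var E)
  | not (F : Fm Loc Var E Γ)
  | and (F F' : Fm Loc Var E Γ)
  | or (F F' : Fm Loc Var E Γ)

namespace Fm

variable {Loc Var E Γ Γ' : Type u}

/-- Truth under an interpretation and a valuation. -/
def Holds (I : Interp Loc Var E) : Fm Loc Var E Γ → Γ → Prop
  | .constr R, g => R g
  | .pred p t, g => I p (t g)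
  | .not F, g => ¬ F.Holds I g
  | .and F F', g => F.Holds I g ∧ F'.Holds I g
  | .or F F', g => F.Holds I g ∨ F'.Holds I g

/-- Substitution for the free variables. -/
def subst (f : Γ' → Γ) : Fm Loc Var E Γ → Fm Loc Var E Γ'
  | .constr R => .constr (fun g => R (f g))
  | .pred p t => .pred p (fun g => t (f g))
  | .not F => .not (F.subst f)
  | .and F F' => .and (F.subst f) (F'.subst f)
  | .or F F' => .or (F.subst f) (F'.subst f)

/-- Equality of truth values. -/
def iff (F F' : Fm Loc Var E Γ) : Fm Loc Var E Γ :=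
  .or (.and F F') (.and (.not F) (.not F'))

/-- Conjunction of a finite list. -/
def conj (l : List (Fm Loc Var E Γ)) : Fm Loc Var E Γ :=
  l.foldr .and (.constr fun _ => True)

/-- Disjunction of a finite list. -/
def disj (l : List (Fm Loc Var E Γ)) : Fm Loc Var E Γ :=
  l.foldr .or (.constr fun _ => False)

end Fm

/-- The relation `R` is well-founded: there is no infinite chain `R x₀ x₁, R x₁ x₂, …`. -/
def NoInfiniteChain {S : Type u} (R : S → S → Prop) : Prop :=
  ¬ ∃ f : ℕ → S, ∀ i, R (f i) (f (i + 1))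

/-- Disjunctive well-foundedness: inclusion in a finite union of well-founded relations. -/
def DisjWF {S : Type u} (R : S → S → Prop) : Prop :=
  ∃ (k : ℕ) (W : Fin k → S → S → Prop),
    (∀ i, NoInfiniteChain (W i)) ∧ ∀ x y, R x y → ∃ i, W i x y

/-- Existential Horn clauses: implications, implications with an existentially quantified
head, and disjunctive well-foundedness conditions on a predicate of two copies of the variables. -/
inductive Clause (Loc Var E : Type u) : Type (u + 1)
  | imp (Γ : Type u) (body head : Fm Loc Var E Γ)
  | impEx (Γ Θ : Type u) (body : Fm Loc Var E Γ) (head : Fm Loc Var E (Γ × Θ))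
  | dwf (n name : ℕ)

/-- A clause is true under an interpretation. -/
def Clause.Holds {Loc Var E : Type u} (I : Interp Loc Var E) : Clause Loc Var E → Prop
  | .imp Γ body head => ∀ g : Γ, body.Holds I g → head.Holds I g
  | .impEx Γ Θ body head => ∀ g : Γ, body.Holds I g → ∃ h : Θ, head.Holds I (g, h)
  | .dwf n name => DisjWF (fun x y => I (.two n name) (x, y))

/-! ### The translation system -/

/-- A program over the program variables and `n` Boolean variables whose components may mention
uninterpreted predicates. -/
structure SymProgram (Loc Var E : Type u) (n : ℕ) where
  init : Fm Loc Var E (State Loc Var E n)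
  next : Fm Loc Var E (State Loc Var E n × State Loc Var E n)
  fair : List (Fm Loc Var E (State Loc Var E n))

section Translation

variable {Loc Var E : Type u}

/-- The formula that an assertion denotes. It is only used for assertions, so the value at other
formulas does not matter. -/
def Formula.toFm {Γ : Type u} : Formula (Fm Loc Var E Γ) → Fm Loc Var E Γ
  | .atom c => c
  | .natom c => .not c
  | .and φ ψ => .and φ.toFm ψ.toFm
  | .or φ ψ => .or φ.toFm ψ.toFm
  | _ => .constr fun _ => False

/-- `p(v)` for a predicate symbol over one copy of the variables. -/
def onePred {n : ℕ} (name : ℕ) : Fm Loc Var E (State Loc Var E n) :=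
  .pred (.one n name) fun s => s

/-- `r(v, v')` for a predicate symbol over two copies of the variables. -/
def twoPred {n : ℕ} (name : ℕ) : Fm Loc Var E (State Loc Var E n × State Loc Var E n) :=
  .pred (.two n name) fun g => g

/-- A formula over `v` as a formula over `v ∪ {x}`. -/
def weaken {n : ℕ} (F : Fm Loc Var E (State Loc Var E n)) :
    Fm Loc Var E (State Loc Var E (n + 1)) :=
  F.subst Prod.fst

/-- The added Boolean variable `x` as a formula over `v ∪ {x}`. -/
def newVar {n : ℕ} : Fm Loc Var E (State Loc Var E (n + 1)) :=
  .constr fun s => s.2 = true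

/-- `F(v)` as a formula over `v, v'`. -/
def cur {Γ : Type u} (F : Fm Loc Var E Γ) : Fm Loc Var E (Γ × Γ) := F.subst Prod.fst

/-- `F(v')` as a formula over `v, v'`. -/
def nxt {Γ : Type u} (F : Fm Loc Var E Γ) : Fm Loc Var E (Γ × Γ) := F.subst Prod.snd

/-- The program obtained by adding a Boolean variable, with initial condition `init`,
the conjunct `test` added to the transition relation and the fairness conditions `fair` added. -/
def SymProgram.extend {n : ℕ} (D : SymProgram Loc Var E n)
    (init : Fm Loc Var E (State Loc Var E (n + 1)))
    (test : Fm Loc Var E (State Loc Var E (n + 1) × State Loc Var E (n + 1)))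
    (fair : List (Fm Loc Var E (State Loc Var E (n + 1)))) : SymProgram Loc Var E (n + 1) where
  init := init
  next := .and (D.next.subst fun g => (g.1.1, g.2.1)) test
  fair := D.fair.map weaken ++ fair

/-- `x = c(v')`. -/
def testX {n : ℕ} (c : Fm Loc Var E (State Loc Var E n)) :
    Fm Loc Var E (State Loc Var E (n + 1) × State Loc Var E (n + 1)) :=
  .iff (cur newVar) (nxt (weaken c))

/-- `x = (c(v) ∧ x')`. -/
def testG {n : ℕ} (c : Fm Loc Var E (State Loc Var E n)) :
    Fm Loc Var E (State Loc Var E (n + 1) × State Loc Var E (n + 1)) :=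
  .iff (cur newVar) (.and (cur (weaken c)) (nxt newVar))

/-- `x ∨ ¬ c(v)`. -/
def fairG {n : ℕ} (c : Fm Loc Var E (State Loc Var E n)) :
    Fm Loc Var E (State Loc Var E (n + 1)) :=
  .or newVar (.not (weaken c))

/-- `x = (c₂(v) ∨ (c₁(v) ∧ x'))`. -/
def testU {n : ℕ} (c₁ c₂ : Fm Loc Var E (State Loc Var E n)) :
    Fm Loc Var E (State Loc Var E (n + 1) × State Loc Var E (n + 1)) :=
  .iff (cur newVar) (.or (cur (weaken c₂)) (.and (cur (weaken c₁)) (nxt newVar)))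

/-- `¬ x ∨ c₂(v)`. -/
def fairU {n : ℕ} (c₂ : Fm Loc Var E (State Loc Var E n)) :
    Fm Loc Var E (State Loc Var E (n + 1)) :=
  .or (.not newVar) (weaken c₂)

/-- The formula `ψ(χ)` over `v` turned into the formula `ψ(x)` over `v ∪ {x}`. -/
noncomputable def elim {n : ℕ} (χ ψ : Formula (Fm Loc Var E (State Loc Var E n))) :
    Formula (Fm Loc Var E (State Loc Var E (n + 1))) :=
  (ψ.map weaken).replace (χ.map weaken) (.atom newVar)

/-- The clause `init(v) → ∃ x, aux(v, x)`. -/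
def exVarClause {n : ℕ} (init : Fm Loc Var E (State Loc Var E n)) (aux : ℕ) :
    Clause Loc Var E :=
  .impEx (State Loc Var E n) (ULift Bool) init
    (.pred (.one (n + 1) aux) fun g => (g.1, g.2.down))

/-- The clauses for `A_f c`. The predicates are named by `p`, `r`, `t`. -/
def clausesAf {n : ℕ} (D : SymProgram Loc Var E n) (c : Fm Loc Var E (State Loc Var E n))
    (p r t : ℕ) : Set (Clause Loc Var E) :=
  { .imp (State Loc Var E n) (.and D.init (.not c)) (onePred p),
    .imp (State Loc Var E n × State Loc Var E n) (.and D.next (cur (onePred p)))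
      (nxt (onePred p)),
    .dwf n r,
    .imp (State Loc Var E n × State Loc Var E n) D.next (twoPred t),
    .imp (State Loc Var E n × State Loc Var E n × State Loc Var E n)
      (.and ((twoPred t).subst fun g => (g.1, g.2.1)) (D.next.subst fun g => (g.2.1, g.2.2)))
      ((twoPred t).subst fun g => (g.1, g.2.2)) }

/-- The clause `p(v₀) ∧ ⋀ i, (t(vᵢ₋₁, vᵢ) ∧ Jᵢ(vᵢ)) → r(v₀, v_{|J|})`. -/
def chainClause {n : ℕ} (D : SymProgram Loc Var E n) (p r t : ℕ) : Clause Loc Var E :=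
  .imp (Fin (D.fair.length + 1) → State Loc Var E n)
    (.and ((onePred p).subst fun g => g 0)
      (.conj ((List.finRange D.fair.length).map fun i =>
        .and ((twoPred t).subst fun g => (g i.castSucc, g i.succ))
          ((D.fair.get i).subst fun g => g i.succ))))
    ((twoPred r).subst fun g => (g 0, g (Fin.last D.fair.length)))

/-- The clauses for `E_f c` when there are fairness conditions. The predicates are named
by `q i`, `r i`, where the fairness conditions are numbered from `0`. -/
def clausesEf {n : ℕ} (D : SymProgram Loc Var E n) (c : Fm Loc Var E (State Loc Var E n))
    (q r : ℕ → ℕ) : Set (Clause Loc Var E) :=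
  { .imp (State Loc Var E n) D.init (.and c (onePred (q 0))) } ∪
    ⋃ i : Fin D.fair.length,
      { .impEx (State Loc Var E n) (State Loc Var E n) (onePred (q i))
          (.and D.next
            (.or (.and (cur (D.fair.get i)) (nxt (onePred (q ((i + 1) % D.fair.length)))))
              (.and (twoPred (r i)) (nxt (onePred (q i)))))),
        .dwf n (r i),
        .imp (State Loc Var E n × State Loc Var E n × State Loc Var E n)
          (.and ((twoPred (r i)).subst fun g => (g.1, g.2.1))
            ((twoPred (r i)).subst fun g => (g.2.1, g.2.2)))
          ((twoPred (r i)).subst fun g => (g.1, g.2.2)) }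

/-- `Trans S D φ S' C`: the translation system can produce the set `C` of clauses for the program
`D` and the state formula `φ`, where `S` holds the predicate symbols that are in use at the start
(so that fresh symbols are taken outside `S`) and `S'` those in use at the end. -/
inductive Trans : {n : ℕ} → Set (Sym Loc) → SymProgram Loc Var E n →
    Formula (Fm Loc Var E (State Loc Var E n)) → Set (Sym Loc) → Set (Clause Loc Var E) → Prop
  | /-- replacement of a basic state subformula by a fresh predicate -/
    basic {n : ℕ} {S S₁ S₂ : Set (Sym Loc)} {D : SymProgram Loc Var E n}
      {φ χ : Formula (Fm Loc Var E (State Loc Var E n))} {C₁ C₂ : Set (Clause Loc Var E)}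
      (aux : ℕ) (hφ : φ.IsState) (hχ : χ.IsBasic) (hc : φ.Contains χ)
      (haux : Sym.one n aux ∉ S)
      (h₁ : Trans (S ∪ {Sym.one n aux}) { D with init := onePred aux } χ S₁ C₁)
      (h₂ : Trans S₁ D (φ.replace χ (.atom (onePred aux))) S₂ C₂) :
      Trans S D φ S₂ (C₁ ∪ C₂)
  | /-- from `E` to `E_f` without fairness conditions -/
    unfairE {n : ℕ} {S S' : Set (Sym Loc)} {D : SymProgram Loc Var E n}
      {ψ : Formula (Fm Loc Var E (State Loc Var E n))} {C : Set (Clause Loc Var E)}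
      (hψ : ψ.QuantFree)
      (h : Trans S { D with fair := [] } (.quant .Ef ψ) S' C) :
      Trans S D (.quant .E ψ) S' C
  | /-- from `A` to `A_f` without fairness conditions -/
    unfairA {n : ℕ} {S S' : Set (Sym Loc)} {D : SymProgram Loc Var E n}
      {ψ : Formula (Fm Loc Var E (State Loc Var E n))} {C : Set (Clause Loc Var E)}
      (hψ : ψ.QuantFree)
      (h : Trans S { D with fair := [] } (.quant .Af ψ) S' C) :
      Trans S D (.quant .A ψ) S' C
  | /-- elimination of `X c` below `A_f` -/
    nextAf {n : ℕ} {S S' : Set (Sym Loc)} {D : SymProgram Loc Var E n}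
      {ψ c : Formula (Fm Loc Var E (State Loc Var E n))} {C : Set (Clause Loc Var E)}
      (hψ : ψ.QuantFree) (hc : c.IsAssertion) (hψc : ψ.Contains (.X c))
      (h : Trans S (D.extend (weaken D.init) (testX c.toFm) [])
        (.quant .Af (elim (.X c) ψ)) S' C) :
      Trans S D (.quant .Af ψ) S' C
  | /-- elimination of `X c` below `E_f` -/
    nextEf {n : ℕ} {S S' : Set (Sym Loc)} {D : SymProgram Loc Var E n}
      {ψ c : Formula (Fm Loc Var E (State Loc Var E n))} {C : Set (Clause Loc Var E)}
      (aux : ℕ) (hψ : ψ.QuantFree) (hc : c.IsAssertion) (hψc : ψ.Contains (.X c))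
      (haux : Sym.one (n + 1) aux ∉ S)
      (h : Trans (S ∪ {Sym.one (n + 1) aux}) (D.extend (onePred aux) (testX c.toFm) [])
        (.quant .Ef (elim (.X c) ψ)) S' C) :
      Trans S D (.quant .Ef ψ) S' ({exVarClause D.init aux} ∪ C)
  | /-- elimination of `G c` below `A_f` -/
    globallyAf {n : ℕ} {S S' : Set (Sym Loc)} {D : SymProgram Loc Var E n}
      {ψ c : Formula (Fm Loc Var E (State Loc Var E n))} {C : Set (Clause Loc Var E)}
      (hψ : ψ.QuantFree) (hc : c.IsAssertion) (hψc : ψ.Contains (.G c))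
      (h : Trans S (D.extend (weaken D.init) (testG c.toFm) [fairG c.toFm])
        (.quant .Af (elim (.G c) ψ)) S' C) :
      Trans S D (.quant .Af ψ) S' C
  | /-- elimination of `G c` below `E_f` -/
    globallyEf {n : ℕ} {S S' : Set (Sym Loc)} {D : SymProgram Loc Var E n}
      {ψ c : Formula (Fm Loc Var E (State Loc Var E n))} {C : Set (Clause Loc Var E)}
      (aux : ℕ) (hψ : ψ.QuantFree) (hc : c.IsAssertion) (hψc : ψ.Contains (.G c))
      (haux : Sym.one (n + 1) aux ∉ S)
      (h : Trans (S ∪ {Sym.one (n + 1) aux})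
        (D.extend (onePred aux) (testG c.toFm) [fairG c.toFm])
        (.quant .Ef (elim (.G c) ψ)) S' C) :
      Trans S D (.quant .Ef ψ) S' ({exVarClause D.init aux} ∪ C)
  | /-- elimination of `c₁ U c₂` below `A_f` -/
    untilAf {n : ℕ} {S S' : Set (Sym Loc)} {D : SymProgram Loc Var E n}
      {ψ c₁ c₂ : Formula (Fm Loc Var E (State Loc Var E n))} {C : Set (Clause Loc Var E)}
      (hψ : ψ.QuantFree) (hc₁ : c₁.IsAssertion) (hc₂ : c₂.IsAssertion)
      (hψc : ψ.Contains (.U c₁ c₂))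
      (h : Trans S (D.extend (weaken D.init) (testU c₁.toFm c₂.toFm) [fairU c₂.toFm])
        (.quant .Af (elim (.U c₁ c₂) ψ)) S' C) :
      Trans S D (.quant .Af ψ) S' C
  | /-- elimination of `c₁ U c₂` below `E_f` -/
    untilEf {n : ℕ} {S S' : Set (Sym Loc)} {D : SymProgram Loc Var E n}
      {ψ c₁ c₂ : Formula (Fm Loc Var E (State Loc Var E n))} {C : Set (Clause Loc Var E)}
      (aux : ℕ) (hψ : ψ.QuantFree) (hc₁ : c₁.IsAssertion) (hc₂ : c₂.IsAssertion)
      (hψc : ψ.Contains (.U c₁ c₂)) (haux : Sym.one (n + 1) aux ∉ S)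
      (h : Trans (S ∪ {Sym.one (n + 1) aux})
        (D.extend (onePred aux) (testU c₁.toFm c₂.toFm) [fairU c₂.toFm])
        (.quant .Ef (elim (.U c₁ c₂) ψ)) S' C) :
      Trans S D (.quant .Ef ψ) S' ({exVarClause D.init aux} ∪ C)
  | /-- `A_f c` with fairness conditions -/
    assertAf {n : ℕ} {S : Set (Sym Loc)} {D : SymProgram Loc Var E n}
      {c : Formula (Fm Loc Var E (State Loc Var E n))} (p r t : ℕ) (hc : c.IsAssertion)
      (hJ : D.fair ≠ []) (hp : Sym.one n p ∉ S) (hr : Sym.two n r ∉ S) (ht : Sym.two n t ∉ S)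
      (hrt : r ≠ t) :
      Trans S D (.quant .Af c) (S ∪ {Sym.one n p, Sym.two n r, Sym.two n t})
        (clausesAf D c.toFm p r t ∪ {chainClause D p r t})
  | /-- `A_f c` without fairness conditions -/
    assertAfEmpty {n : ℕ} {S : Set (Sym Loc)} {D : SymProgram Loc Var E n}
      {c : Formula (Fm Loc Var E (State Loc Var E n))} (p r t : ℕ) (hc : c.IsAssertion)
      (hJ : D.fair = []) (hp : Sym.one n p ∉ S) (hr : Sym.two n r ∉ S) (ht : Sym.two n t ∉ S)
      (hrt : r ≠ t) :
      Trans S D (.quant .Af c) (S ∪ {Sym.one n p, Sym.two n r, Sym.two n t})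
        (clausesAf D c.toFm p r t ∪
          {.imp (State Loc Var E n × State Loc Var E n) (.and (cur (onePred p)) (twoPred t))
            (twoPred r)})
  | /-- `E_f c` with fairness conditions -/
    assertEf {n : ℕ} {S : Set (Sym Loc)} {D : SymProgram Loc Var E n}
      {c : Formula (Fm Loc Var E (State Loc Var E n))} (q r : ℕ → ℕ) (hc : c.IsAssertion)
      (hJ : D.fair ≠ [])
      (hq : ∀ i < D.fair.length, Sym.one n (q i) ∉ S)
      (hr : ∀ i < D.fair.length, Sym.two n (r i) ∉ S)
      (hqi : Set.InjOn q (Set.Iio D.fair.length)) (hri : Set.InjOn r (Set.Iio D.fair.length)) :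
      Trans S D (.quant .Ef c)
        (S ∪ {s | ∃ i < D.fair.length, s = Sym.one n (q i) ∨ s = Sym.two n (r i)})
        (clausesEf D c.toFm q r)
  | /-- `E_f c` without fairness conditions -/
    assertEfEmpty {n : ℕ} {S : Set (Sym Loc)} {D : SymProgram Loc Var E n}
      {c : Formula (Fm Loc Var E (State Loc Var E n))} (q : ℕ) (hc : c.IsAssertion)
      (hJ : D.fair = []) (hq : Sym.one n q ∉ S) :
      Trans S D (.quant .Ef c) (S ∪ {Sym.one n q})
        { .imp (State Loc Var E n) D.init (.and c.toFm (onePred q)),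
          .impEx (State Loc Var E n) (State Loc Var E n) (onePred q)
            (.and D.next (nxt (onePred q))) }
  | /-- an assertion -/
    assertion {n : ℕ} {S : Set (Sym Loc)} {D : SymProgram Loc Var E n}
      {c : Formula (Fm Loc Var E (State Loc Var E n))} (hc : c.IsAssertion) :
      Trans S D c S {.imp (State Loc Var E n) D.init c.toFm}

end Translation

/-! ### Partial programs and synthesis -/

/-- Condition holes `⟨l, l_t, l_f⟩` and assignment holes `⟨l, l'⟩`. -/
inductive Hole (Loc : Type u) : Type u
  | cond (l lt lf : Loc)
  | asgn (l l' : Loc)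

/-- A program over the variables `{pc} ∪ v_r` with a finite set of holes. -/
structure PartialProgram (Loc Var E : Type u) where
  prog : Program (PState Loc Var E)
  holes : Finset (Hole Loc)

/-- A map from holes to sets (condition holes) and relations (assignment holes) of valuations of
the variables `v_r`. Only its values at the holes of a given partial program are ever used. -/
structure Filling (Loc Var E : Type u) where
  cond : Loc → Loc → Loc → Set (Var → E)
  asgn : Loc → Loc → (Var → E) → (Var → E) → Prop

namespace PartialProgram

variable {Loc Var E : Type u}

/-- A filling is a resolving function if the relation at every assignment hole is total. -/
def IsResolving (P : PartialProgram Loc Var E) (Ψ : Filling Loc Var E) : Prop :=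
  ∀ l l', Hole.asgn l l' ∈ P.holes → ∀ x, ∃ x', Ψ.asgn l l' x x'

/-- The synthesized program. -/
def synthesized (P : PartialProgram Loc Var E) (Ψ : Filling Loc Var E) :
    Program (PState Loc Var E) where
  init := P.prog.init
  next s s' :=
    (∃ l lt lf, Hole.cond l lt lf ∈ P.holes ∧
      s.pc = l ∧ s'.pc = lt ∧ s.vr ∈ Ψ.cond l lt lf ∧ s'.vr = s.vr) ∨
    (∃ l lt lf, Hole.cond l lt lf ∈ P.holes ∧
      s.pc = l ∧ s'.pc = lf ∧ s.vr ∉ Ψ.cond l lt lf ∧ s'.vr = s.vr) ∨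
    (∃ l l', Hole.asgn l l' ∈ P.holes ∧ s.pc = l ∧ s'.pc = l' ∧ Ψ.asgn l l' s.vr s'.vr) ∨
    P.prog.next s s'
  fair := P.prog.fair

/-- The transitions through a hole that is filled with its uninterpreted predicate. -/
def holeStep : Hole Loc → Fm Loc Var E (PState Loc Var E × PState Loc Var E)
  | .cond l lt lf =>
      .or
        (.and (.constr fun g => g.1.pc = l ∧ g.2.pc = lt)
          (.and (.pred (.cond l) fun g => g.1.vr) (.constr fun g => g.2.vr = g.1.vr)))
        (.and (.constr fun g => g.1.pc = l ∧ g.2.pc = lf)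
          (.and (.not (.pred (.cond l) fun g => g.1.vr)) (.constr fun g => g.2.vr = g.1.vr)))
  | .asgn l l' =>
      .and (.constr fun g => g.1.pc = l ∧ g.2.pc = l')
        (.pred (.asgn l) fun g => (g.1.vr, g.2.vr))

/-- The program `P_U`, with the holes filled by uninterpreted predicates. -/
noncomputable def withPreds (P : PartialProgram Loc Var E) : SymProgram Loc Var E 0 where
  init := .constr P.prog.init
  next := .or (.constr fun g => P.prog.next g.1 g.2) (.disj (P.holes.toList.map holeStep))
  fair := P.prog.fair.map .constr

/-- The set `U` of the predicate symbols of the holes. -/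
def holeSyms (P : PartialProgram Loc Var E) : Set (Sym Loc) :=
  {u | (∃ l lt lf, Hole.cond l lt lf ∈ P.holes ∧ u = .cond l) ∨
    ∃ l l', Hole.asgn l l' ∈ P.holes ∧ u = .asgn l}

/-- The clauses `⊤ → ∃ v_r', u^a_l(v_r, v_r')` for the assignment holes. -/
def asgnClauses (P : PartialProgram Loc Var E) : Set (Clause Loc Var E) :=
  {C | ∃ l l', Hole.asgn l l' ∈ P.holes ∧
    C = .impEx (Var → E) (Var → E) (.constr fun _ => True) (.pred (.asgn l) fun g => g)}

/-- `Δ` is one of the sets `Δ_a(P, H) ∪ Clauses(P_U, φ)` that the translation can produce. -/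
def Produces (P : PartialProgram Loc Var E) (φ : Formula (PState Loc Var E → Prop))
    (Δ : Set (Clause Loc Var E)) : Prop :=
  ∃ S' C, Trans P.holeSyms P.withPreds (φ.map .constr) S' C ∧ Δ = P.asgnClauses ∪ C

end PartialProgram

end EHC

namespace EHC

universe v

variable {Loc Var E : Type v}

/-! Once the interpretation is fixed, every symbolic program denotes an ordinary one
(`SymProgram.eval`). `Trans.sound` shows, by induction on the derivation, that this program
satisfies the formula whenever the produced clauses are true. The theorem follows because `P_U`
denotes exactly the synthesized program, and the clauses for assignment holes say that the filling
is total.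

Only underapproximations are needed: in negation normal form a formula is monotone in its replaced
subformulas (`Formula.pathSat_of_replace`). So it suffices that `aux` implies the basic formula it
stands for, and that the Boolean `x` implies the temporal formula it prophesies. Under `E_f`, a path
of the extended program is projected; under `A_f`, a fair path is lifted by giving `x` the actual
truth value of that formula.

For `A_f c`, a fair path from an initial state violating `c` satisfies `p` everywhere, and `t`
relates all its ordered pairs. Sampling it at visits to the fairness conditions in cyclic order
yields an infinite sequence with all ordered pairs in `r`, which the Ramsey argument
`DisjWF.not_forall_lt` forbids. For `E_f c`, the existential heads build a path stage by stage; `r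
i` is transitive and disjunctively well-founded, so no stage lasts forever and each condition
recurs. -/

theorem Fm.holds_subst {Γ Γ' : Type v} (I : Interp Loc Var E) (f : Γ' → Γ) (F : Fm Loc Var E Γ)
    (g : Γ') : (F.subst f).Holds I g ↔ F.Holds I (f g) := by
  induction F <;> simp_all [Fm.subst, Fm.Holds]

theorem Fm.holds_iff {Γ : Type v} (I : Interp Loc Var E) (F F' : Fm Loc Var E Γ) (g : Γ) :
    (F.iff F').Holds I g ↔ (F.Holds I g ↔ F'.Holds I g) := by
  simp only [Fm.iff, Fm.Holds]
  tauto

theorem Fm.holds_conj {Γ : Type v} (I : Interp Loc Var E) (l : List (Fm Loc Var E Γ)) (g : Γ) :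
    (Fm.conj l).Holds I g ↔ ∀ F ∈ l, F.Holds I g := by
  induction l with
  | nil => simp [Fm.conj, Fm.Holds]
  | cons F l ih =>
    rw [List.forall_mem_cons, ← ih]
    rfl

theorem Fm.holds_disj {Γ : Type v} (I : Interp Loc Var E) (l : List (Fm Loc Var E Γ)) (g : Γ) :
    (Fm.disj l).Holds I g ↔ ∃ F ∈ l, F.Holds I g := by
  induction l with
  | nil => simp [Fm.disj, Fm.Holds]
  | cons F l ih =>
    rw [List.exists_mem_cons_iff, ← ih]
    rfl

/-- The program that a symbolic program denotes under an interpretation. -/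
def SymProgram.eval {n : ℕ} (I : Interp Loc Var E) (D : SymProgram Loc Var E n) :
    Program (State Loc Var E n) where
  init s := D.init.Holds I s
  next s s' := D.next.Holds I (s, s')
  fair := D.fair.map fun F => F.Holds I

/-! ### Formulas -/

/-- Temporal operators evaluate their arguments on suffixes, so facts about fair paths must pass to
suffixes. -/
theorem Program.IsFairPath.shift {σ : Type v} {D : Program σ} {π : ℕ → σ} (h : D.IsFairPath π)
    (i : ℕ) : D.IsFairPath fun k => π (k + i) := by
  refine ⟨fun k => ?_, fun j hj k => ?_⟩
  · have := h.1 (k + i)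
    rwa [Nat.add_right_comm] at this
  · obtain ⟨m, hm, hjm⟩ := h.2 j hj (k + i)
    refine ⟨m - i, by omega, ?_⟩
    simpa only [Nat.sub_add_cancel (show i ≤ m by omega)] using hjm

namespace Formula

variable {α β γ : Type v}

theorem map_map (f : α → β) (g : β → γ) (φ : Formula α) :
    (φ.map f).map g = φ.map fun a => g (f a) := by
  induction φ <;> simp_all [map]

theorem map_self (φ : Formula α) : (φ.map fun a => a) = φ := by
  induction φ <;> simp_all [map]

theorem IsState.map {φ : Formula α} (h : φ.IsState) (f : α → β) : (φ.map f).IsState := by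
  induction φ <;> simp_all [IsState, Formula.map]

theorem QuantFree.map {φ : Formula α} (h : φ.QuantFree) (f : α → β) : (φ.map f).QuantFree := by
  induction φ <;> simp_all [QuantFree, Formula.map]

theorem IsAssertion.isState {φ : Formula α} (h : φ.IsAssertion) : φ.IsState := by
  induction φ <;> simp_all [IsState, IsAssertion]

theorem stateSat_iff_pathSat {σ : Type v} (D : Program σ) {φ : Formula (σ → Prop)}
    (h : φ.IsState) (π : ℕ → σ) : φ.StateSat D (π 0) ↔ φ.PathSat D π := by
  induction φ <;> simp_all [IsState, StateSat, PathSat]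

theorem stateSat_assertion {n : ℕ} (I : Interp Loc Var E) (D : Program (State Loc Var E n))
    {c : Formula (Fm Loc Var E (State Loc Var E n))} (h : c.IsAssertion) (s : State Loc Var E n) :
    (c.map fun F => F.Holds I).StateSat D s ↔ c.toFm.Holds I s := by
  induction c <;> simp_all [IsAssertion, StateSat, toFm, Fm.Holds, Formula.map]

theorem pathSat_assertion {n : ℕ} (I : Interp Loc Var E) (D : Program (State Loc Var E n))
    {c : Formula (Fm Loc Var E (State Loc Var E n))} (h : c.IsAssertion)
    (π : ℕ → State Loc Var E n) :
    (c.map fun F => F.Holds I).PathSat D π ↔ c.toFm.Holds I (π 0) := by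
  rw [← stateSat_assertion I D h, stateSat_iff_pathSat D (h.isState.map _)]

/-- Weakening a positively occurring subformula weakens the formula. -/
theorem pathSat_of_replace {σ : Type v} (D : Program σ) (f : α → σ → Prop) {χ η : Formula α}
    (good : (ℕ → σ) → Prop) (hgood : ∀ π i, good π → good fun k => π (k + i))
    (h : ∀ π, good π → (η.map f).PathSat D π → (χ.map f).PathSat D π) (φ : Formula α)
    (hφ : φ.QuantFree ∨ ∀ π, good π) (π : ℕ → σ) (hπ : good π)
    (hs : ((φ.replace χ η).map f).PathSat D π) : (φ.map f).PathSat D π := by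
  induction φ generalizing π with
  | atom c =>
    simp only [replace] at hs
    split_ifs at hs with e
    · exact e ▸ h π hπ hs
    · exact hs
  -- A negated literal is a leaf for `replace`: nothing is rewritten below a negation, so an
  -- implication suffices.
  | natom c =>
    simp only [replace] at hs
    split_ifs at hs with e
    · exact e ▸ h π hπ hs
    · exact hs
  | and φ ψ ih₁ ih₂ =>
    simp only [replace] at hs
    split_ifs at hs with e
    · exact e ▸ h π hπ hs
    · exact ⟨ih₁ (hφ.imp_left And.left) π hπ hs.1, ih₂ (hφ.imp_left And.right) π hπ hs.2⟩
  | or φ ψ ih₁ ih₂ =>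
    simp only [replace] at hs
    split_ifs at hs with e
    · exact e ▸ h π hπ hs
    · exact Or.imp (ih₁ (hφ.imp_left And.left) π hπ) (ih₂ (hφ.imp_left And.right) π hπ) hs
  | X φ ih =>
    simp only [replace] at hs
    split_ifs at hs with e
    · exact e ▸ h π hπ hs
    · exact ih hφ _ (hgood π 1 hπ) hs
  | G φ ih =>
    simp only [replace] at hs
    split_ifs at hs with e
    · exact e ▸ h π hπ hs
    · exact fun i => ih hφ _ (hgood π i hπ) (hs i)
  | U φ ψ ih₁ ih₂ =>
    simp only [replace] at hs
    split_ifs at hs with e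
    · exact e ▸ h π hπ hs
    · obtain ⟨j, hj, hi⟩ := hs
      exact ⟨j, ih₂ (hφ.imp_left And.right) _ (hgood π j hπ) hj,
        fun i hij => ih₁ (hφ.imp_left And.left) _ (hgood π i hπ) (hi i hij)⟩
  | quant Q φ ih =>
    simp only [replace] at hs
    split_ifs at hs with e
    · exact e ▸ h π hπ hs
    -- A path quantifier moves to a new path, about which `good π` says nothing.
    · have hall : ∀ π, good π := hφ.resolve_left id
      cases Q with
      | E => exact hs.imp fun π' h' => ⟨h'.1, h'.2.1, ih (.inr hall) π' (hall π') h'.2.2⟩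
      | A => exact fun π' h₁ h₂ => ih (.inr hall) π' (hall π') (hs π' h₁ h₂)
      | Ef => exact hs.imp fun π' h' => ⟨h'.1, h'.2.1, ih (.inr hall) π' (hall π') h'.2.2⟩
      | Af => exact fun π' h₁ h₂ => ih (.inr hall) π' (hall π') (hs π' h₁ h₂)

/-- The program enters path satisfaction only through path quantifiers. -/
theorem pathSat_of_quantFree {σ : Type v} {D D' : Program σ} {ψ : Formula (σ → Prop)}
    (h : ψ.QuantFree) (π : ℕ → σ) : ψ.PathSat D π ↔ ψ.PathSat D' π := by
  induction ψ generalizing π <;> simp_all [PathSat, QuantFree]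

theorem pathSat_weaken {n : ℕ} (I : Interp Loc Var E) (D : Program (State Loc Var E n))
    (D' : Program (State Loc Var E (n + 1))) {ψ : Formula (Fm Loc Var E (State Loc Var E n))}
    (h : ψ.QuantFree) (π : ℕ → State Loc Var E (n + 1)) :
    ((ψ.map weaken).map fun F => F.Holds I).PathSat D' π ↔
      (ψ.map fun F => F.Holds I).PathSat D fun k => (π k).1 := by
  induction ψ generalizing π with
  | atom c => exact Fm.holds_subst I _ _ _
  | natom c => exact not_congr (Fm.holds_subst I _ _ _)
  | and φ ψ ih₁ ih₂ => exact and_congr (ih₁ h.1 π) (ih₂ h.2 π)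
  | or φ ψ ih₁ ih₂ => exact or_congr (ih₁ h.1 π) (ih₂ h.2 π)
  | X φ ih => exact ih h _
  | G φ ih => exact forall_congr' fun i => ih h _
  | U φ ψ ih₁ ih₂ =>
    exact exists_congr fun j => and_congr (ih₂ h.2 _)
      (forall_congr' fun i => forall_congr' fun _ => ih₁ h.1 _)
  | quant Q φ ih => exact h.elim

end Formula

/-! ### Elimination of temporal operators by prophecy variables -/

section Prophecy

variable {n : ℕ} (I : Interp Loc Var E) (D : SymProgram Loc Var E n)
  (init : Fm Loc Var E (State Loc Var E (n + 1)))
  (test : Fm Loc Var E (State Loc Var E (n + 1) × State Loc Var E (n + 1)))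
  (fair : List (Fm Loc Var E (State Loc Var E (n + 1))))

theorem isFairPath_extend (π : ℕ → State Loc Var E (n + 1)) :
    ((D.extend init test fair).eval I).IsFairPath π ↔
      (D.eval I).IsFairPath (fun k => (π k).1) ∧ (∀ i, test.Holds I (π i, π (i + 1))) ∧
        ∀ F ∈ fair, ∀ i, ∃ k, i ≤ k ∧ F.Holds I (π k) := by
  simp only [Program.IsFairPath, Program.IsPath, SymProgram.eval, SymProgram.extend, weaken,
    Fm.Holds, Fm.holds_subst, List.map_append, List.map_map, List.mem_append, List.mem_map,
    forall_and, or_imp, forall_exists_index, and_imp, forall_apply_eq_imp_iff₂,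
    Function.comp_apply]
  tauto

/-- The added Boolean variable is true only where `χ` holds. -/
def Prophesies (χ : Formula (Fm Loc Var E (State Loc Var E n))) : Prop :=
  ∀ π : ℕ → State Loc Var E (n + 1), ((D.extend init test fair).eval I).IsFairPath π →
    (π 0).2 = true → (χ.map fun F => F.Holds I).PathSat (D.eval I) fun k => (π k).1

variable {I D init test fair} {χ ψ : Formula (Fm Loc Var E (State Loc Var E n))}

/-- The implication from `x` to `χ` is available at every position, since suffixes of fair paths are
fair; monotonicity then carries it through `ψ`. -/
theorem Prophesies.pathSat (h : Prophesies I D init test fair χ) (hχ : χ.QuantFree)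
    (hψ : ψ.QuantFree) {π : ℕ → State Loc Var E (n + 1)}
    (hπ : ((D.extend init test fair).eval I).IsFairPath π)
    (hs : ((elim χ ψ).map fun F => F.Holds I).PathSat ((D.extend init test fair).eval I) π) :
    (ψ.map fun F => F.Holds I).PathSat (D.eval I) fun k => (π k).1 := by
  rw [← Formula.pathSat_weaken I (D.eval I) ((D.extend init test fair).eval I) hψ]
  refine Formula.pathSat_of_replace _ _ ((D.extend init test fair).eval I).IsFairPath
    (fun π i h => h.shift i) (fun π hπ hx => ?_) _ (.inl (hψ.map _)) π hπ hs
  exact (Formula.pathSat_weaken I (D.eval I) _ hχ π).2 (h π hπ hx)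

theorem stateSat_Ef_of_elim (h : Prophesies I D init test fair χ) (hχ : χ.QuantFree)
    (hψ : ψ.QuantFree) {s : State Loc Var E n} {x : Bool}
    (hs : ((Formula.quant .Ef (elim χ ψ)).map fun F => F.Holds I).StateSat
      ((D.extend init test fair).eval I) (s, x)) :
    ((Formula.quant .Ef ψ).map fun F => F.Holds I).StateSat (D.eval I) s := by
  obtain ⟨π, hπ, h0, hs⟩ := hs
  exact ⟨fun k => (π k).1, ((isFairPath_extend I D init test fair π).1 hπ).1,
    congrArg Prod.fst h0, h.pathSat hχ hψ hπ hs⟩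

/-- The first bit of the lifted path depends on the whole path, not just on `s`; hence the
assumption for both values of `x`. -/
theorem stateSat_Af_of_elim (h : Prophesies I D init test fair χ) (hχ : χ.QuantFree)
    (hψ : ψ.QuantFree)
    (hlift : ∀ π : ℕ → State Loc Var E n, (D.eval I).IsFairPath π → ∃ x : ℕ → Bool,
      (∀ i, test.Holds I ((π i, x i), (π (i + 1), x (i + 1)))) ∧
        ∀ F ∈ fair, ∀ i, ∃ k, i ≤ k ∧ F.Holds I (π k, x k))
    {s : State Loc Var E n}
    (hs : ∀ x, ((Formula.quant .Af (elim χ ψ)).map fun F => F.Holds I).StateSat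
      ((D.extend init test fair).eval I) (s, x)) :
    ((Formula.quant .Af ψ).map fun F => F.Holds I).StateSat (D.eval I) s := by
  intro π hπ h0
  obtain ⟨x, hx₁, hx₂⟩ := hlift π hπ
  have hπ' := (isFairPath_extend I D init test fair fun k => (π k, x k)).2 ⟨hπ, hx₁, hx₂⟩
  exact h.pathSat hχ hψ hπ' (hs (x 0) _ hπ' (by rw [h0]))

/-! ### Prophecy variables for X, G and U -/

variable {c c₁ c₂ : Formula (Fm Loc Var E (State Loc Var E n))}

theorem Formula.IsAssertion.quantFree {α : Type v} {c : Formula α} (h : c.IsAssertion) :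
    c.QuantFree := by
  induction c <;> simp_all [Formula.IsAssertion, Formula.QuantFree]

theorem testX_holds (c : Fm Loc Var E (State Loc Var E n))
    (g : State Loc Var E (n + 1) × State Loc Var E (n + 1)) :
    (testX c).Holds I g ↔ (g.1.2 = true ↔ c.Holds I g.2.1) := by
  simp only [testX, cur, nxt, newVar, weaken, Fm.holds_iff, Fm.holds_subst, Fm.Holds]

theorem testG_holds (c : Fm Loc Var E (State Loc Var E n))
    (g : State Loc Var E (n + 1) × State Loc Var E (n + 1)) :
    (testG c).Holds I g ↔ (g.1.2 = true ↔ c.Holds I g.1.1 ∧ g.2.2 = true) := by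
  simp only [testG, cur, nxt, newVar, weaken, Fm.holds_iff, Fm.holds_subst, Fm.Holds]

theorem testU_holds (c₁ c₂ : Fm Loc Var E (State Loc Var E n))
    (g : State Loc Var E (n + 1) × State Loc Var E (n + 1)) :
    (testU c₁ c₂).Holds I g ↔
      (g.1.2 = true ↔ c₂.Holds I g.1.1 ∨ c₁.Holds I g.1.1 ∧ g.2.2 = true) := by
  simp only [testU, cur, nxt, newVar, weaken, Fm.holds_iff, Fm.holds_subst, Fm.Holds]

theorem fairG_holds (c : Fm Loc Var E (State Loc Var E n)) (s : State Loc Var E (n + 1)) :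
    (fairG c).Holds I s ↔ (s.2 = true ∨ ¬ c.Holds I s.1) := by
  simp only [fairG, newVar, weaken, Fm.holds_subst, Fm.Holds]

theorem fairU_holds (c : Fm Loc Var E (State Loc Var E n)) (s : State Loc Var E (n + 1)) :
    (fairU c).Holds I s ↔ (¬ s.2 = true ∨ c.Holds I s.1) := by
  simp only [fairU, newVar, weaken, Fm.holds_subst, Fm.Holds]

theorem prophesies_X (hc : c.IsAssertion) :
    Prophesies I D init (testX c.toFm) fair (.X c) := by
  intro π hπ hx
  have h := ((isFairPath_extend _ _ _ _ _ _).1 hπ).2.1 0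
  exact (Formula.pathSat_assertion I _ hc _).2 (((testX_holds _ _).1 h).1 hx)

/-- The test alone propagates a true `x` forward forever, forcing `c` at each step; G is a greatest
fixed point. -/
theorem prophesies_G (hc : c.IsAssertion) :
    Prophesies I D init (testG c.toFm) fair (.G c) := by
  intro π hπ hx
  have h := fun i => (testG_holds _ _).1 (((isFairPath_extend _ _ _ _ _ _).1 hπ).2.1 i)
  have hall : ∀ i, (π i).2 = true := fun i => by
    induction i with
    | zero => exact hx
    | succ i ih => exact ((h i).1 ih).2
  intro i
  have := ((h i).1 (hall i)).1
  exact (Formula.pathSat_assertion I _ hc _).2 (by simpa using this)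

/-- The test would allow `x` to remain true while `c₂` is postponed forever; the added fairness
condition excludes this. Up to the first `c₂`, the bit stays true and forces `c₁`. -/
theorem prophesies_U (hc₁ : c₁.IsAssertion) (hc₂ : c₂.IsAssertion) :
    Prophesies I D init (testU c₁.toFm c₂.toFm) [fairU c₂.toFm] (.U c₁ c₂) := by
  intro π hπ hx
  obtain ⟨-, h₁, h₂⟩ := (isFairPath_extend _ _ _ _ _ _).1 hπ
  have h := fun i => (testU_holds _ _ _).1 (h₁ i)
  have hex : ∃ j, c₂.toFm.Holds I (π j).1 := by
    by_contra! hno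
    have hall : ∀ i, (π i).2 = true := fun i => by
      induction i with
      | zero => exact hx
      | succ i ih => exact (((h i).1 ih).resolve_left (hno i)).2
    obtain ⟨k, -, hk⟩ := h₂ _ (List.mem_singleton.2 rfl) 0
    exact ((fairU_holds _ _).1 hk).elim (fun h => h (hall k)) (hno k)
  classical
  have hmin := fun i (hi : i < Nat.find hex) => Nat.find_min hex hi
  have hall : ∀ i, i ≤ Nat.find hex → (π i).2 = true := fun i hi => by
    induction i with
    | zero => exact hx
    | succ i ih => exact (((h i).1 (ih (by omega))).resolve_left (hmin i (by omega))).2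
  refine ⟨Nat.find hex, (Formula.pathSat_assertion I _ hc₂ _).2 ?_, fun i hi =>
    (Formula.pathSat_assertion I _ hc₁ _).2 ?_⟩
  · simpa using Nat.find_spec hex
  · simpa using (((h i).1 (hall i hi.le)).resolve_left (hmin i hi)).1

theorem lift_X (c : Fm Loc Var E (State Loc Var E n)) (π : ℕ → State Loc Var E n) :
    ∃ x : ℕ → Bool, (∀ i, (testX c).Holds I ((π i, x i), (π (i + 1), x (i + 1)))) ∧
      ∀ F ∈ ([] : List (Fm Loc Var E (State Loc Var E (n + 1)))),
        ∀ i, ∃ k, i ≤ k ∧ F.Holds I (π k, x k) := by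
  classical
  exact ⟨fun i => decide (c.Holds I (π (i + 1))), fun i => (testX_holds _ _).2 (by simp),
    by simp⟩

theorem lift_G (c : Fm Loc Var E (State Loc Var E n)) (π : ℕ → State Loc Var E n) :
    ∃ x : ℕ → Bool, (∀ i, (testG c).Holds I ((π i, x i), (π (i + 1), x (i + 1)))) ∧
      ∀ F ∈ [fairG c], ∀ i, ∃ k, i ≤ k ∧ F.Holds I (π k, x k) := by
  classical
  refine ⟨fun i => decide (∀ k, i ≤ k → c.Holds I (π k)), fun i => (testG_holds _ _).2 ?_, ?_⟩
  · simp only [decide_eq_true_eq]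
    refine ⟨fun h => ⟨h i le_rfl, fun k hk => h k (by omega)⟩, fun h k hk => ?_⟩
    rcases hk.eq_or_lt with rfl | hk
    · exact h.1
    · exact h.2 k hk
  · intro F hF i
    rw [List.mem_singleton.1 hF]
    suffices h : ∃ k, i ≤ k ∧ ((∀ m, k ≤ m → c.Holds I (π m)) ∨ ¬ c.Holds I (π k)) from
      h.imp fun k hk => ⟨hk.1, (fairG_holds c _).2 (hk.2.imp_left fun h => decide_eq_true h)⟩
    -- Either the bit is true already at `i`, or a later violation of `c` meets the fairness
    -- condition.
    by_cases h : ∀ k, i ≤ k → c.Holds I (π k)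
    · exact ⟨i, le_rfl, .inl h⟩
    · push Not at h
      exact h.imp fun k hk => ⟨hk.1, .inr hk.2⟩

theorem lift_U (c₁ c₂ : Fm Loc Var E (State Loc Var E n)) (π : ℕ → State Loc Var E n) :
    ∃ x : ℕ → Bool, (∀ i, (testU c₁ c₂).Holds I ((π i, x i), (π (i + 1), x (i + 1)))) ∧
      ∀ F ∈ [fairU c₂], ∀ i, ∃ k, i ≤ k ∧ F.Holds I (π k, x k) := by
  classical
  refine ⟨fun i => decide (∃ j, i ≤ j ∧ c₂.Holds I (π j) ∧
    ∀ k, i ≤ k → k < j → c₁.Holds I (π k)), fun i => (testU_holds _ _ _).2 ?_, ?_⟩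
  · simp only [decide_eq_true_eq]
    constructor
    · rintro ⟨j, hij, hj, h⟩
      rcases hij.eq_or_lt with rfl | hij
      · exact .inl hj
      · exact .inr ⟨h i le_rfl hij, j, hij, hj, fun k hk => h k (by omega)⟩
    · rintro (h | ⟨h, j, hij, hj, h'⟩)
      · exact ⟨i, le_rfl, h, fun k h₁ h₂ => absurd h₂ (by omega)⟩
      · refine ⟨j, by omega, hj, fun k hk hkj => ?_⟩
        rcases hk.eq_or_lt with rfl | hk
        · exact h
        · exact h' k hk hkj
  · intro F hF i
    rw [List.mem_singleton.1 hF]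
    suffices h : ∃ k, i ≤ k ∧ ((¬ ∃ j, k ≤ j ∧ c₂.Holds I (π j) ∧
        ∀ m, k ≤ m → m < j → c₁.Holds I (π m)) ∨ c₂.Holds I (π k)) from
      h.imp fun k hk =>
        ⟨hk.1, (fairU_holds c₂ _).2 (hk.2.imp_left fun h => mt of_decide_eq_true h)⟩
    -- If the until formula holds at `i`, its witness satisfies `c₂`; otherwise the bit is false at
    -- `i` itself.
    by_cases h : ∃ j, i ≤ j ∧ c₂.Holds I (π j) ∧ ∀ k, i ≤ k → k < j → c₁.Holds I (π k)
    · obtain ⟨j, hij, hj, -⟩ := h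
      exact ⟨j, hij, .inr hj⟩
    · exact ⟨i, le_rfl, .inl h⟩

end Prophecy

/-! ### Disjunctive well-foundedness -/

/-- A consequence of Ramsey's theorem: no sequence has all of its ordered pairs in a
disjunctively well-founded relation. -/
theorem DisjWF.not_forall_lt {S : Type v} {R : S → S → Prop} (h : DisjWF R) (f : ℕ → S) :
    ¬ ∀ m n, m < n → R (f m) (f n) := by
  obtain ⟨k, W, hW, hR⟩ := h
  intro hf
  -- The sequence is generalized so that the induction on the number of relations may pass to
  -- subsequences.
  have key : ∀ (k : ℕ) (W : Fin k → S → S → Prop), (∀ i, NoInfiniteChain (W i)) →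
      ∀ f : ℕ → S, (∀ m n, m < n → ∃ i, W i (f m) (f n)) → False := by
    intro k
    induction k with
    | zero => exact fun W _ f hf => (hf 0 1 one_pos).choose.elim0
    | succ k ih =>
      intro W hW f hf
      -- A subsequence is either an infinite chain of `W 0` or avoids `W 0` on all ordered pairs,
      -- leaving one relation fewer.
      obtain ⟨g, hg | hg⟩ := exists_increasing_or_nonincreasing_subseq' (W 0) f
      · exact hW 0 ⟨fun m => f (g m), hg⟩
      · refine ih (fun i => W i.succ) (fun i => hW _) (fun m => f (g m)) fun m n hmn => ?_
        obtain ⟨i, hi⟩ := hf (g m) (g n) (g.strictMono hmn)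
        cases i using Fin.cases with
        | zero => exact absurd hi (hg m n hmn)
        | succ i => exact ⟨i, hi⟩
  exact key k W hW f fun m n hmn => hR _ _ (hf m n hmn)

/-! ### Clauses for `A_f c` and `E_f c` -/

section Assertions

variable {n : ℕ} {I : Interp Loc Var E} {D : SymProgram Loc Var E n}
  {c : Fm Loc Var E (State Loc Var E n)}

theorem isFairPath_eval {π : ℕ → State Loc Var E n} :
    (D.eval I).IsFairPath π ↔ (D.eval I).IsPath π ∧
      ∀ i : Fin D.fair.length, ∀ k, ∃ m, k ≤ m ∧ (D.fair.get i).Holds I (π m) := by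
  refine and_congr_right fun _ => ⟨fun h i => h _ (List.mem_map_of_mem (List.get_mem _ i)),
    fun h j hj => ?_⟩
  obtain ⟨F, hF, rfl⟩ := List.mem_map.1 hj
  obtain ⟨i, rfl⟩ := List.get_of_mem hF
  exact h i

/-- On a path that violates `c` initially, the invariant `p` holds everywhere and `t` connects
every two states. -/
theorem clausesAf_path {p r t : ℕ} (h : ∀ C ∈ clausesAf D c p r t, C.Holds I)
    {π : ℕ → State Loc Var E n} (hπ : (D.eval I).IsPath π) (hi : D.init.Holds I (π 0))
    (hc : ¬ c.Holds I (π 0)) :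
    (∀ k, I (.one n p) (π k)) ∧ (∀ k m, k < m → I (.two n t) (π k, π m)) ∧
      DisjWF fun x y => I (.two n r) (x, y) := by
  simp only [clausesAf, Set.mem_insert_iff, Set.mem_singleton_iff, forall_eq_or_imp, forall_eq,
    Clause.Holds, Fm.Holds, onePred, twoPred, cur, nxt, Fm.holds_subst] at h
  obtain ⟨h₁, h₂, h₃, h₄, h₅⟩ := h
  refine ⟨fun k => ?_, fun k m hkm => ?_, h₃⟩
  · induction k with
    | zero => exact h₁ _ ⟨hi, hc⟩
    | succ k ih => exact h₂ (π k, π (k + 1)) ⟨hπ k, ih⟩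
  · induction m, hkm using Nat.le_induction with
    | base => exact h₄ _ (hπ k)
    | succ m _ ih => exact h₅ (π k, π m, π (m + 1)) ⟨ih, hπ m⟩

theorem holds_of_clausesAf_empty {p r t : ℕ} (h : ∀ C ∈ clausesAf D c p r t, C.Holds I)
    (h' : (Clause.imp (State Loc Var E n × State Loc Var E n)
      (.and (cur (onePred p)) (twoPred t)) (twoPred r)).Holds I)
    {π : ℕ → State Loc Var E n} (hπ : (D.eval I).IsPath π) (hi : D.init.Holds I (π 0)) :
    c.Holds I (π 0) := by
  by_contra hc
  obtain ⟨hp, ht, hr⟩ := clausesAf_path h hπ hi hc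
  exact hr.not_forall_lt π fun k m hkm => h' (π k, π m) ⟨hp k, ht k m hkm⟩

theorem holds_of_clausesAf {p r t : ℕ} (hJ : D.fair ≠ [])
    (h : ∀ C ∈ clausesAf D c p r t, C.Holds I) (h' : (chainClause D p r t).Holds I)
    {π : ℕ → State Loc Var E n} (hπ : (D.eval I).IsFairPath π) (hi : D.init.Holds I (π 0)) :
    c.Holds I (π 0) := by
  by_contra hc
  obtain ⟨hp, ht, hr⟩ := clausesAf_path h hπ.1 hi hc
  simp only [chainClause, Clause.Holds, Fm.Holds, onePred, twoPred, Fm.holds_subst,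
    Fm.holds_conj, List.mem_map, List.mem_finRange, true_and, forall_exists_index,
    forall_apply_eq_imp_iff] at h'
  have hfair := (isFairPath_eval.1 hπ).2
  set N := D.fair.length with hN
  have hN0 : 0 < N := List.length_pos_iff.2 hJ
  have hstep : ∀ m a : ℕ, ∃ b, a < b ∧
      (D.fair.get ⟨m % N, Nat.mod_lt _ hN0⟩).Holds I (π b) := fun m a => hfair _ (a + 1)
  choose nx hnx hnxJ using hstep
  -- Sampled positions: `g (m + 1)` is a visit to condition number `m % N` strictly after `g m`.
  let g : ℕ → ℕ := fun m => Nat.rec 0 nx m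
  have hg : StrictMono g := strictMono_nat_of_lt_succ fun m => hnx m (g m)
  have hgJ : ∀ m (i : Fin N), m % N = i → (D.fair.get i).Holds I (π (g (m + 1))) := by
    intro m i hmi
    obtain rfl : (⟨m % N, Nat.mod_lt _ hN0⟩ : Fin N) = i := Fin.ext hmi
    exact hnxJ m (g m)
  refine hr.not_forall_lt (fun a => π (g (N * a))) fun a b hab => ?_
  have hab' : N * a + N ≤ N * b := by
    calc N * a + N = N * (a + 1) := by ring
      _ ≤ N * b := Nat.mul_le_mul_left _ hab
  -- The chain follows one round of samples from `N * a`, but its last point jumps to `N * b`. That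
  -- sample also visits the last condition, so the chain clause relates arbitrary round starts `a <
  -- b`, not only consecutive ones.
  let idx : ℕ → ℕ := fun i => if i = N then N * b else N * a + i
  have hidx0 : idx 0 = N * a := by simp [idx, hN0.ne]
  have hidxN : idx N = N * b := by simp [idx]
  have := h' (fun i => π (g (idx i))) ⟨hp _, fun i => ⟨ht _ _ (hg ?_), ?_⟩⟩
  · simpa [hidx0, ← hN, hidxN] using this
  · have := i.2
    simp only [idx, Fin.val_castSucc, Fin.val_succ]
    split_ifs <;> omega
  · have hiN := i.2
    by_cases e : (i : ℕ) + 1 = N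
    · have e' : N * b = (N * (b - 1) + i) + 1 := by
        obtain ⟨b, rfl⟩ : ∃ b', b = b' + 1 := ⟨b - 1, by omega⟩
        rw [Nat.add_sub_cancel, mul_add, add_assoc, e, mul_one]
      have := hgJ (N * (b - 1) + i) i (by rw [Nat.mul_add_mod, Nat.mod_eq_of_lt hiN])
      rw [← e'] at this
      simpa [idx, e] using this
    · have := hgJ (N * a + i) i (by rw [Nat.mul_add_mod, Nat.mod_eq_of_lt hiN])
      simpa [idx, e, add_assoc] using this

theorem exists_path_of_clausesEf_empty {q : ℕ}
    (h : ∀ s : State Loc Var E n, I (.one n q) s →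
      ∃ s', D.next.Holds I (s, s') ∧ I (.one n q) s')
    {s : State Loc Var E n} (hs : I (.one n q) s) : ∃ π, (D.eval I).IsPath π ∧ π 0 = s := by
  choose f hf₁ hf₂ using h
  let g : ℕ → {s // I (.one n q) s} := fun k => Nat.rec ⟨s, hs⟩ (fun _ a => ⟨_, hf₂ a.1 a.2⟩) k
  exact ⟨fun k => (g k).1, fun k => hf₁ (g k).1 (g k).2, rfl⟩

/-- The state is paired with the condition currently awaited: each step either meets it and advances
the index cyclically, or stays and moves along `r i`. -/
theorem exists_fairPath_of_clausesEf {q r : ℕ → ℕ} (hJ : D.fair ≠ [])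
    (hstep : ∀ i : Fin D.fair.length, ∀ s : State Loc Var E n, I (.one n (q i)) s →
      ∃ s', D.next.Holds I (s, s') ∧
        (((D.fair.get i).Holds I s ∧ I (.one n (q ((i + 1) % D.fair.length))) s') ∨
          (I (.two n (r i)) (s, s') ∧ I (.one n (q i)) s')))
    (hwf : ∀ i : Fin D.fair.length, DisjWF fun x y => I (.two n (r i)) (x, y))
    (htrans : ∀ i : Fin D.fair.length, ∀ x y z, I (.two n (r i)) (x, y) →
      I (.two n (r i)) (y, z) → I (.two n (r i)) (x, z))
    {s : State Loc Var E n} (hs : I (.one n (q 0)) s) :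
    ∃ π, (D.eval I).IsFairPath π ∧ π 0 = s := by
  set N := D.fair.length with hN
  have hN0 : 0 < N := List.length_pos_iff.2 hJ
  have hstep' : ∀ a : {a : Fin N × State Loc Var E n // I (.one n (q a.1)) a.2},
      ∃ b : {a : Fin N × State Loc Var E n // I (.one n (q a.1)) a.2},
        D.next.Holds I (a.1.2, b.1.2) ∧
          (((D.fair.get a.1.1).Holds I a.1.2 ∧ (b.1.1 : ℕ) = (a.1.1 + 1) % N) ∨
            (I (.two n (r a.1.1)) (a.1.2, b.1.2) ∧ b.1.1 = a.1.1)) := by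
    rintro ⟨⟨i, s⟩, hs⟩
    obtain ⟨s', h₁, ⟨h₂, h₃⟩ | ⟨h₂, h₃⟩⟩ := hstep i s hs
    · exact ⟨⟨(⟨(i + 1) % N, Nat.mod_lt _ hN0⟩, s'), h₃⟩, h₁, .inl ⟨h₂, rfl⟩⟩
    · exact ⟨⟨(i, s'), h₃⟩, h₁, .inr ⟨h₂, rfl⟩⟩
  choose f hf₁ hf₂ using hstep'
  let g : ℕ → {a : Fin N × State Loc Var E n // I (.one n (q a.1)) a.2} :=
    fun k => Nat.rec ⟨(⟨0, hN0⟩, s), hs⟩ (fun _ a => f a) k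
  let π : ℕ → State Loc Var E n := fun k => (g k).1.2
  let ix : ℕ → Fin N := fun k => (g k).1.1
  have hπ : ∀ k, D.next.Holds I (π k, π (k + 1)) := fun k => hf₁ (g k)
  have hcase : ∀ k, ((D.fair.get (ix k)).Holds I (π k) ∧ (ix (k + 1) : ℕ) = (ix k + 1) % N) ∨
      (I (.two n (r (ix k))) (π k, π (k + 1)) ∧ ix (k + 1) = ix k) := fun k => hf₂ (g k)
  clear_value ix
  have hadv : ∀ k, ∃ m, k ≤ m ∧ (D.fair.get (ix m)).Holds I (π m) ∧ ix m = ix k ∧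
      (ix (m + 1) : ℕ) = (ix k + 1) % N := by
    intro k
    by_contra! hno
    have hst : ∀ m, k ≤ m → ix m = ix k := fun m hm => by
      induction m, hm using Nat.le_induction with
      | base => rfl
      | succ m hm ih =>
        rcases hcase m with h | h
        · exact absurd (ih ▸ h.2) (hno m hm h.1 ih)
        · exact h.2.trans ih
    have hr : ∀ m, k ≤ m → I (.two n (r (ix k))) (π m, π (m + 1)) := fun m hm => by
      rcases hcase m with h | h
      · exact absurd (hst m hm ▸ h.2) (hno m hm h.1 (hst m hm))
      · exact hst m hm ▸ h.1
    -- Transitivity extends `r` from consecutive states to all ordered pairs, as the Ramsey argument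
    -- requires.
    refine (hwf (ix k)).not_forall_lt (fun m => π (k + m)) fun a b hab => ?_
    induction b, hab using Nat.le_induction with
    | base => exact hr _ (by omega)
    | succ b _ ih => exact htrans _ _ _ _ ih (hr (k + b) (by omega))
  -- The index at `m + 1` is recorded because the next stage starts there.
  have hcyc : ∀ k d, ∃ m, k ≤ m ∧ (D.fair.get (ix m)).Holds I (π m) ∧
      (ix m : ℕ) = (ix k + d) % N ∧ (ix (m + 1) : ℕ) = (ix k + d + 1) % N := by
    intro k d
    induction d with
    | zero =>
      obtain ⟨m, h₁, h₂, h₃, h₄⟩ := hadv k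
      exact ⟨m, h₁, h₂, by rw [h₃, Nat.add_zero, Nat.mod_eq_of_lt (ix k).2], h₄⟩
    | succ d ih =>
      obtain ⟨m, h₁, -, -, h₄⟩ := ih
      obtain ⟨m', h₁', h₂', h₃', h₄'⟩ := hadv (m + 1)
      refine ⟨m', by omega, h₂', by rw [h₃', h₄, add_assoc], ?_⟩
      rw [h₄', h₄, Nat.mod_add_mod, add_assoc (ix k : ℕ)]
  refine ⟨π, isFairPath_eval.2 ⟨hπ, fun i k => ?_⟩, rfl⟩
  -- This many stages lead from index `ix k` to `N + i`, that is, to `i` modulo `N`.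
  obtain ⟨m, h₁, h₂, h₃, -⟩ := hcyc k (N - ix k + i)
  have e : ix m = i := by
    apply Fin.ext
    have := (ix k).2
    rw [h₃, ← add_assoc, Nat.add_sub_cancel' this.le, Nat.add_mod_left, Nat.mod_eq_of_lt i.2]
  exact ⟨m, h₁, e ▸ h₂⟩

end Assertions

/-! ### Soundness of the translation -/

theorem Trans.isState {n : ℕ} {S S' : Set (Sym Loc)} {D : SymProgram Loc Var E n}
    {φ : Formula (Fm Loc Var E (State Loc Var E n))} {C : Set (Clause Loc Var E)}
    (h : Trans S D φ S' C) : φ.IsState := by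
  cases h with
  | basic _ hφ => exact hφ
  | assertion hc => exact hc.isState
  | _ => trivial

theorem exVarClause_holds {n : ℕ} {I : Interp Loc Var E}
    {init : Fm Loc Var E (State Loc Var E n)} {aux : ℕ} {C : Set (Clause Loc Var E)}
    (h : ∀ c ∈ {exVarClause init aux} ∪ C, c.Holds I) {s : State Loc Var E n}
    (hs : init.Holds I s) : ∃ x, I (.one (n + 1) aux) (s, x) := by
  obtain ⟨x, hx⟩ := h (exVarClause init aux) (.inl rfl) s hs
  exact ⟨x.down, hx⟩

theorem Trans.sound {n : ℕ} {S S' : Set (Sym Loc)} {D : SymProgram Loc Var E n}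
    {φ : Formula (Fm Loc Var E (State Loc Var E n))} {C : Set (Clause Loc Var E)}
    (h : Trans S D φ S' C) (I : Interp Loc Var E) (hI : ∀ c ∈ C, c.Holds I) :
    (D.eval I).Satisfies (φ.map fun F => F.Holds I) := by
  induction h with
  | @basic n _ _ _ D φ χ _ _ aux hφ hχ hc haux h₁ h₂ ih₁ ih₂ =>
    intro s hs
    have k₁ := ih₁ fun c hc => hI c (.inl hc)
    have k₂ := ih₂ (fun c hc => hI c (.inr hc)) s hs
    -- A state formula sees only the first state, so any sequence starting in `s` will do; it need
    -- not be a path.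
    rw [Formula.stateSat_iff_pathSat _ (h₂.isState.map _) fun _ => s] at k₂
    rw [Formula.stateSat_iff_pathSat _ (hφ.map _) fun _ => s]
    refine Formula.pathSat_of_replace _ _ (fun _ => True) (fun _ _ _ => trivial)
      (fun π _ hx => ?_) _ (.inr fun _ => trivial) _ trivial k₂
    have := k₁ (π 0) hx
    cases χ with
    | quant Q ψ =>
      -- The clauses for `χ` concern the program started in `aux`, whose paths and fairness are
      -- those of `D`.
      have e : ∀ π, (ψ.map fun F => F.Holds I).PathSat
          (SymProgram.eval I { D with init := onePred aux }) π ↔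
          (ψ.map fun F => F.Holds I).PathSat (D.eval I) π :=
        Formula.pathSat_of_quantFree (hχ.map fun F => F.Holds I)
      cases Q with
      | E => exact this.imp fun π' h' => ⟨h'.1, h'.2.1, (e π').1 h'.2.2⟩
      | A => exact fun π' h₁ h₂ => (e π').1 (this π' h₁ h₂)
      | Ef => exact this.imp fun π' h' => ⟨h'.1, h'.2.1, (e π').1 h'.2.2⟩
      | Af => exact fun π' h₁ h₂ => (e π').1 (this π' h₁ h₂)
    | _ => exact hχ.elim
  | unfairE hψ h ih =>
    intro s hs
    obtain ⟨π, hπ, h0, hsat⟩ := ih hI s hs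
    exact ⟨π, hπ.1, h0, (Formula.pathSat_of_quantFree (hψ.map _) π).1 hsat⟩
  | unfairA hψ h ih =>
    intro s hs π hπ h0
    exact (Formula.pathSat_of_quantFree (hψ.map _) π).1
      (ih hI s hs π ⟨hπ, fun _ hj => absurd hj List.not_mem_nil⟩ h0)
  | nextAf hψ hc hψc h ih =>
    exact fun s hs => stateSat_Af_of_elim (prophesies_X hc) hc.quantFree hψ
      (fun π _ => lift_X _ π) fun x => ih hI (s, x) ((Fm.holds_subst _ _ _ _).2 hs)
  | nextEf aux hψ hc hψc haux h ih =>
    intro s hs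
    obtain ⟨x, hx⟩ := exVarClause_holds hI hs
    exact stateSat_Ef_of_elim (prophesies_X hc) hc.quantFree hψ
      (ih (fun c hc => hI c (.inr hc)) (s, x) hx)
  | globallyAf hψ hc hψc h ih =>
    exact fun s hs => stateSat_Af_of_elim (prophesies_G hc) hc.quantFree hψ
      (fun π _ => lift_G _ π) fun x => ih hI (s, x) ((Fm.holds_subst _ _ _ _).2 hs)
  | globallyEf aux hψ hc hψc haux h ih =>
    intro s hs
    obtain ⟨x, hx⟩ := exVarClause_holds hI hs
    exact stateSat_Ef_of_elim (prophesies_G hc) hc.quantFree hψ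
      (ih (fun c hc => hI c (.inr hc)) (s, x) hx)
  | untilAf hψ hc₁ hc₂ hψc h ih =>
    exact fun s hs => stateSat_Af_of_elim (prophesies_U hc₁ hc₂)
      ⟨hc₁.quantFree, hc₂.quantFree⟩ hψ (fun π _ => lift_U _ _ π)
      fun x => ih hI (s, x) ((Fm.holds_subst _ _ _ _).2 hs)
  | untilEf aux hψ hc₁ hc₂ hψc haux h ih =>
    intro s hs
    obtain ⟨x, hx⟩ := exVarClause_holds hI hs
    exact stateSat_Ef_of_elim (prophesies_U hc₁ hc₂) ⟨hc₁.quantFree, hc₂.quantFree⟩ hψ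
      (ih (fun c hc => hI c (.inr hc)) (s, x) hx)
  | assertAf p r t hc hJ =>
    intro s hs π hπ h0
    subst h0
    exact (Formula.pathSat_assertion I _ hc π).2 (holds_of_clausesAf hJ
      (fun C hC => hI C (.inl hC)) (hI _ (.inr rfl)) hπ hs)
  | assertAfEmpty p r t hc hJ =>
    intro s hs π hπ h0
    subst h0
    exact (Formula.pathSat_assertion I _ hc π).2 (holds_of_clausesAf_empty
      (fun C hC => hI C (.inl hC)) (hI _ (.inr rfl)) hπ.1 hs)
  | assertEf q r hc hJ =>
    intro s hs
    simp only [clausesEf, Set.mem_union, Set.mem_iUnion, Set.mem_insert_iff,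
      Set.mem_singleton_iff] at hI
    have hinit := hI _ (.inl rfl) s hs
    have hstep := fun i => hI _ (.inr ⟨i, .inl rfl⟩)
    have hwf := fun i => hI _ (.inr ⟨i, .inr (.inl rfl)⟩)
    have htrans := fun i => hI _ (.inr ⟨i, .inr (.inr rfl)⟩)
    simp only [Clause.Holds, Fm.Holds, onePred, twoPred, cur, nxt, Fm.holds_subst, and_imp]
      at hinit hstep hwf htrans
    obtain ⟨π, hπ, h0⟩ := exists_fairPath_of_clausesEf hJ hstep hwf
      (fun i x y z => htrans i (x, y, z)) hinit.2
    exact ⟨π, hπ, h0, (Formula.pathSat_assertion I _ hc π).2 (h0 ▸ hinit.1)⟩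
  | assertEfEmpty q hc hJ =>
    intro s hs
    have hinit := hI _ (.inl rfl) s hs
    have hstep := hI _ (.inr rfl)
    simp only [Clause.Holds, Fm.Holds, onePred, nxt, Fm.holds_subst] at hinit hstep
    obtain ⟨π, hπ, h0⟩ := exists_path_of_clausesEf_empty hstep hinit.2
    refine ⟨π, ⟨hπ, ?_⟩, h0, (Formula.pathSat_assertion I _ hc π).2 (h0 ▸ hinit.1)⟩
    simp [SymProgram.eval, hJ]
  | assertion hc =>
    exact fun s hs => (Formula.stateSat_assertion I _ hc s).2 (hI _ rfl s hs)

/-! ### Filling the holes -/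

theorem PartialProgram.eval_withPreds (P : PartialProgram Loc Var E) (I : Interp Loc Var E)
    (Ψ : Filling Loc Var E)
    (hcond : ∀ l lt lf, Hole.cond l lt lf ∈ P.holes → ∀ x, x ∈ Ψ.cond l lt lf ↔ I (.cond l) x)
    (hasgn : ∀ l l', Hole.asgn l l' ∈ P.holes →
      ∀ x x', Ψ.asgn l l' x x' ↔ I (.asgn l) (x, x')) :
    P.withPreds.eval I = P.synthesized Ψ := by
  have hnext : ∀ s s', (P.withPreds.eval I).next s s' ↔ (P.synthesized Ψ).next s s' := by
    intro s s'
    simp only [SymProgram.eval, withPreds, synthesized, Fm.Holds, Fm.holds_disj, List.mem_map,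
      Finset.mem_toList]
    constructor
    · rintro (h | ⟨_, ⟨⟨l, lt, lf⟩ | ⟨l, l'⟩, hH, rfl⟩, h⟩)
      · exact .inr (.inr (.inr h))
      · rcases h with ⟨⟨h₁, h₂⟩, h₃, h₄⟩ | ⟨⟨h₁, h₂⟩, h₃, h₄⟩
        · exact .inl ⟨l, lt, lf, hH, h₁, h₂, (hcond _ _ _ hH _).2 h₃, h₄⟩
        · exact .inr (.inl ⟨l, lt, lf, hH, h₁, h₂, fun h => h₃ ((hcond _ _ _ hH _).1 h), h₄⟩)
      · exact .inr (.inr (.inl ⟨l, l', hH, h.1.1, h.1.2, (hasgn _ _ hH _ _).2 h.2⟩))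
    · rintro (⟨l, lt, lf, hH, h₁, h₂, h₃, h₄⟩ | ⟨l, lt, lf, hH, h₁, h₂, h₃, h₄⟩ |
        ⟨l, l', hH, h₁, h₂, h₃⟩ | h)
      · exact .inr ⟨_, ⟨_, hH, rfl⟩, .inl ⟨⟨h₁, h₂⟩, (hcond _ _ _ hH _).1 h₃, h₄⟩⟩
      · exact .inr ⟨_, ⟨_, hH, rfl⟩,
          .inr ⟨⟨h₁, h₂⟩, fun h => h₃ ((hcond _ _ _ hH _).2 h), h₄⟩⟩
      · exact .inr ⟨_, ⟨_, hH, rfl⟩, ⟨h₁, h₂⟩, (hasgn _ _ hH _ _).1 h₃⟩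
      · exact .inl h
  have hn : (P.withPreds.eval I).next = (P.synthesized Ψ).next :=
    funext fun s => funext fun s' => propext (hnext s s')
  have hf : (P.withPreds.eval I).fair = (P.synthesized Ψ).fair := by
    simp only [SymProgram.eval, withPreds, synthesized, List.map_map]
    exact List.map_id _
  exact congrArg₂ (Program.mk P.prog.init) hn hf

end EHC

theorem theorem5 {Loc Var E : Type u} (P : EHC.PartialProgram Loc Var E)
    (φ : EHC.Formula (EHC.PState Loc Var E → Prop)) (hφ : φ.IsState)
    (Δ : Set (EHC.Clause Loc Var E)) (hΔ : P.Produces φ Δ)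
    (I : EHC.Interp Loc Var E) (hI : ∀ C ∈ Δ, C.Holds I)
    (Ψ : EHC.Filling Loc Var E)
    (hcond : ∀ l lt lf, EHC.Hole.cond l lt lf ∈ P.holes →
      ∀ x, x ∈ Ψ.cond l lt lf ↔ I (.cond l) x)
    (hasgn : ∀ l l', EHC.Hole.asgn l l' ∈ P.holes →
      ∀ x x', Ψ.asgn l l' x x' ↔ I (.asgn l) (x, x')) :
    P.IsResolving Ψ ∧ (P.synthesized Ψ).Satisfies φ := by
  obtain ⟨S', C, hC, rfl⟩ := hΔ
  refine ⟨fun l l' h x => ?_, ?_⟩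
  · obtain ⟨x', hx'⟩ := hI _ (.inl ⟨l, l', h, rfl⟩) x trivial
    exact ⟨x', (hasgn l l' h x x').2 hx'⟩
  · have := hC.sound I fun c hc => hI c (.inr hc)
    rw [P.eval_withPreds I Ψ hcond hasgn, EHC.Formula.map_map] at this
    -- Embedding an assertion as a constraint and then evaluating it gives the assertion back.
    rw [← φ.map_self]
    exact this
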